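/- Let $k$ be a field and $n\ge 1$ an integer. Let $\Delta_n$ be the cyclic quiver with vertices $1,\dots,n$ (read modulo $n$) and one arrow $x_a\colon a\to a+1$ for each vertex $a$. Let $A$ be a finite-dimensional Nakayama algebra of order $n$, i.e. a finite-dimensional $k$-algebra with a fixed isomorphism from $k\Delta_n/(\mathcal R)$ to $A$, where $\mathcal R$ is a finite set of paths of length $\geq 1$ and $(\mathcal R)$ is the two-sided ideal it generates. Paths are composed from left to right and modules are right modules. For a vertex $a$ let $e_a\in A$ be the corresponding idempotent, $P_a=e_aA$, $S_a=P_a/\operatorname{rad}P_a$ the simple module at $a$, $I_a=\operatorname{Hom}_k(Ae_a,k)$ the injective module at $a$, and $q_a=\dim_k I_a$. Define the map $\psi$ on the vertices by $\psi(a)=a-q_a \pmod n$ (its functional graph is the coresolution quiver of $A$). For a finite-dimensional module $M$ let $\Omega(M)$ be the kernel of a projective cover of $M$, let $\Omega^{0}(M)=M$ and $\Omega^{i+1}(M)=\Omega(\Omega^i(M))$. Let $m\ge 0$ be an integer, and let $a$ be a vertex with $\operatorname{pd} S_a\ge 2m-1$. Then for every vertex $b$, the simple module $S_b$ is a subfactor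 of $\Omega^{2m}(S_a)$, i.e. isomorphic to $X/Y$ for some submodules $Y\subseteq X\subseteq\Omega^{2m}(S_a)$ (equivalently, a composition factor), if and only if $\psi^m(b)=a$. -/

import Mathlib

open CategoryTheory MulOpposite

universe u v

noncomputable section

namespace Nakayama

/-! The cyclic quiver `Δ_n` has vertex set `ZMod n` (with `n` the class of `0`) and exactly one
arrow `x_a : a ⟶ a + 1` for every vertex `a`; here `n ≥ 1` throughout. -/

/-- A path in the cyclic quiver. Since exactly one arrow leaves every vertex, a path is the same
thing as its starting vertex `a` together with its length `l`: the path
`x_a x_{a+1} ⋯ x_{a+l-1}` from `a` to `a + l`. -/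
@[ext]
structure CyclicPath (n : ℕ) where
  start : ZMod n
  length : ℕ

/-- The end vertex of a path. -/
def CyclicPath.target {n : ℕ} (p : CyclicPath n) : ZMod n := p.start + (p.length : ZMod n)

/-- The path algebra `kΔ_n`: the `k`-vector space with basis the paths of `Δ_n`. -/
def PathAlgebra (k : Type u) [Field k] (n : ℕ) : Type u := CyclicPath n →₀ k

namespace PathAlgebra

variable (k : Type u) [Field k] (n : ℕ)

instance : AddCommGroup (PathAlgebra k n) :=
  inferInstanceAs (AddCommGroup (CyclicPath n →₀ k))

instance : Module k (PathAlgebra k n) :=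
  inferInstanceAs (Module k (CyclicPath n →₀ k))

variable {n}

/-- The basis element of the path algebra given by a path. -/
def ofPath (p : CyclicPath n) : PathAlgebra k n := Finsupp.single p (1 : k)

/-- The product of two paths: `p q` is "first `p`, then `q`" if `q` starts where `p` ends,
and is `0` otherwise. -/
def pathMul (p q : CyclicPath n) : PathAlgebra k n :=
  open Classical in
  if p.target = q.start then ofPath k ⟨p.start, p.length + q.length⟩ else 0

variable (n)

/-- The bilinear extension of the product of paths. -/
def mulHom : PathAlgebra k n →ₗ[k] PathAlgebra k n →ₗ[k] PathAlgebra k n :=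
  Finsupp.linearCombination k fun p : CyclicPath n =>
    (Finsupp.linearCombination k fun q : CyclicPath n => pathMul k p q :
      (CyclicPath n →₀ k) →ₗ[k] PathAlgebra k n)

instance : Mul (PathAlgebra k n) := ⟨fun x y => mulHom k n x y⟩

/-- The unit is the sum of the trivial paths. -/
instance [NeZero n] : One (PathAlgebra k n) := ⟨∑ a : ZMod n, ofPath k ⟨a, 0⟩⟩

variable {k n}

theorem mul_def (x y : PathAlgebra k n) : x * y = mulHom k n x y := rfl

theorem one_def [NeZero n] : (1 : PathAlgebra k n) = ∑ a : ZMod n, ofPath k ⟨a, 0⟩ := rfl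

theorem ofPath_mul_ofPath (p q : CyclicPath n) :
    ofPath k p * ofPath k q = pathMul k p q := by
  have h1 : mulHom k n (ofPath k p) = _ :=
    (Finsupp.linearCombination_single k (1 : k) p).trans (one_smul k _)
  rw [mul_def, h1]
  exact (Finsupp.linearCombination_single k (1 : k) q).trans (one_smul k _)

theorem hom_ext {M : Type*} [AddCommMonoid M] [Module k M] {f g : PathAlgebra k n →ₗ[k] M}
    (h : ∀ p, f (ofPath k p) = g (ofPath k p)) : f = g :=
  Finsupp.lhom_ext' fun p => LinearMap.ext_ring (h p)

theorem mulHom_ofPath (p q : CyclicPath n) :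
    mulHom k n (ofPath k p) (ofPath k q) = pathMul k p q := ofPath_mul_ofPath p q

theorem mul_assoc' (x y z : PathAlgebra k n) : x * y * z = x * (y * z) := by
  have key : (mulHom k n).compr₂ (mulHom k n) =
      ((LinearMap.llcomp k _ _ _).flip (mulHom k n)).comp
        (LinearMap.llcomp k _ _ _ ∘ₗ mulHom k n) := by
    refine hom_ext fun p => hom_ext fun q => hom_ext fun r => ?_
    simp only [LinearMap.compr₂_apply, LinearMap.comp_apply, LinearMap.flip_apply,
      LinearMap.llcomp_apply, mulHom_ofPath, pathMul]
    by_cases h1 : p.target = q.start <;> by_cases h2 : q.target = r.start <;>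
      simp [h1, h2, mulHom_ofPath, pathMul] <;>
      simp_all [CyclicPath.target, add_assoc, ← h1]
  exact congrArg (fun f => f x y z) key

variable [NeZero n]

theorem one_mul' (x : PathAlgebra k n) : 1 * x = x := by
  have key : mulHom k n 1 = LinearMap.id := by
    refine hom_ext fun p => ?_
    simp [one_def, mulHom_ofPath, pathMul, CyclicPath.target]
  exact congrArg (fun f => f x) key

theorem mul_one' (x : PathAlgebra k n) : x * 1 = x := by
  have key : (mulHom k n).flip 1 = LinearMap.id := by
    refine hom_ext fun p => ?_
    simp [one_def, mulHom_ofPath, pathMul]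
  exact congrArg (fun f => f x) key

instance : Ring (PathAlgebra k n) where
  __ := (inferInstance : AddCommGroup (PathAlgebra k n))
  mul_assoc := mul_assoc'
  one_mul := one_mul'
  mul_one := mul_one'
  left_distrib x y z := by simp [mul_def]
  right_distrib x y z := by simp [mul_def]
  zero_mul x := by simp [mul_def]
  mul_zero x := by simp [mul_def]

instance : Algebra k (PathAlgebra k n) :=
  Algebra.ofModule (fun r x y => by simp [mul_def]) (fun r x y => by simp [mul_def])

end PathAlgebra

/-- The quotient of the path algebra `kΔ_n` by the two-sided ideal generated by the paths in `R`. -/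
abbrev BoundAlgebra (k : Type u) [Field k] {n : ℕ} [NeZero n] (R : Finset (CyclicPath n)) :
    Type u :=
  (TwoSidedIdeal.span (PathAlgebra.ofPath k '' (R : Set (CyclicPath n)))).ringCon.Quotient

/-- The structure of a Nakayama algebra of order `n` on a `k`-algebra `A`: an isomorphism of
`A` with the quotient of `kΔ_n` by an ideal generated by a finite set of nontrivial paths. -/
structure NakayamaStructure (k : Type u) [Field k] (n : ℕ) [NeZero n]
    (A : Type v) [Ring A] [Algebra k A] where
  relations : Finset (CyclicPath n)
  length_pos : ∀ p ∈ relations, 0 < p.length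
  iso : BoundAlgebra k relations ≃ₐ[k] A

namespace NakayamaStructure

variable {k : Type u} [Field k] {n : ℕ} [NeZero n] {A : Type v} [Ring A] [Algebra k A]
  (N : NakayamaStructure k n A)

/-- The idempotent `e_a` of `A`, the image of the trivial path at `a`. -/
def e (a : ZMod n) : A :=
  N.iso (RingCon.toQuotient (PathAlgebra.ofPath k ⟨a, 0⟩ : PathAlgebra k n))

/-- The indecomposable projective right module `P_a = e_a A`, as a right ideal of `A`.
Right `A`-modules are modules over `Aᵐᵒᵖ`. -/
def P (a : ZMod n) : Submodule Aᵐᵒᵖ A := Submodule.span Aᵐᵒᵖ {N.e a}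

/-- The simple right module `S_a` at the vertex `a`: the top `P_a / rad P_a` of `P_a`. -/
def S (a : ZMod n) : ModuleCat.{v} Aᵐᵒᵖ :=
  ModuleCat.of Aᵐᵒᵖ (N.P a ⧸ Module.jacobson Aᵐᵒᵖ (N.P a))

/-- The injective right module `I_a = D(A e_a)`, the `k`-dual of the left ideal `A e_a`. -/
def I (a : ZMod n) : Type (max u v) := Module.Dual k (Ideal.span {N.e a} : Ideal A)

instance (a : ZMod n) : AddCommGroup (N.I a) :=
  inferInstanceAs (AddCommGroup (Module.Dual k (Ideal.span {N.e a} : Ideal A)))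

instance (a : ZMod n) : Module k (N.I a) :=
  inferInstanceAs (Module k (Module.Dual k (Ideal.span {N.e a} : Ideal A)))

/-- The right action of `A` on `I_a`: `(f x)(y) = f (x y)`. -/
instance (a : ZMod n) : Module Aᵐᵒᵖ (N.I a) where
  smul x f := LinearMap.comp (show Module.Dual k (Ideal.span {N.e a} : Ideal A) from f)
    (Module.toModuleEnd k (S := A) (Ideal.span {N.e a} : Ideal A) x.unop)
  one_smul f := LinearMap.ext fun y => congrArg f.toFun (one_smul A y)
  mul_smul x x' f := LinearMap.ext fun y => congrArg f.toFun (mul_smul x'.unop x.unop y)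
  smul_zero _ := rfl
  smul_add _ _ _ := rfl
  add_smul x x' f := LinearMap.ext fun y =>
    (congrArg f.toFun (add_smul x.unop x'.unop y)).trans (f.map_add' _ _)
  zero_smul f := LinearMap.ext fun y => (congrArg f.toFun (zero_smul A y)).trans f.map_zero

/-- `q_a = dim_k I_a`. -/
def q (a : ZMod n) : ℕ := Module.finrank k (N.I a)

/-- The map `ψ(a) = τ^{-q_a}(a)` of the coresolution quiver, where `τ(a) = a + 1`. -/
def ψ (a : ZMod n) : ZMod n := a - (N.q a : ZMod n)

end NakayamaStructure

section Modules

variable {R : Type u} [Ring R]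

/-- A projective cover of `M`: a projective module `P` with a surjection onto `M` whose kernel is
superfluous. -/
structure ProjectiveCover (M : ModuleCat.{v} R) where
  P : ModuleCat.{v} R
  projective : Module.Projective R P
  π : P →ₗ[R] M
  surjective : Function.Surjective π
  superfluous : ∀ X : Submodule R P, X ⊔ LinearMap.ker π = ⊤ → X = ⊤

open Classical in
/-- The syzygy `Ω(M)`: the kernel of a projective cover of `M`. It is well defined up to
isomorphism (with value `0` if `M` has no projective cover, which does not occur for finitely
generated modules over an Artinian ring). -/
def syzygy (M : ModuleCat.{v} R) : ModuleCat.{v} R :=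
  if h : Nonempty (ProjectiveCover M) then ModuleCat.of R (LinearMap.ker h.some.π)
  else ModuleCat.of R PUnit

/-- `S` is a subfactor of `M`: it is isomorphic to `X / Y` for submodules `Y ≤ X` of `M`. For `S`
simple and `M` of finite length this says that `S` is a composition factor of `M`. -/
def IsSubfactor (S M : ModuleCat.{v} R) : Prop :=
  ∃ X Y : Submodule R M, Y ≤ X ∧ Nonempty ((X ⧸ Y.submoduleOf X) ≃ₗ[R] S)

end Modules

end Nakayama

end

/-! The relations are paths, so the nonzero paths form a basis of A. As a vector space P_a is
k[X]/(X^c_a), with X^j the path of length j from a, and the right ideals needed are the `J a l`.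
Left multiplication by the path of length l maps P_{a+l} onto `J a l`, so Ω(`J a l`) ≅ `J (a+l) (c a
- l)` when l < c_a.

Lift the vertices to ℤ and put f(x) = x + c_x (`cInt`). The factors of `K (x, y)` sit at the
integers of [y, f(x)), and ΩK(x, y) = K(y, f(x)) when K(x, y) is nonzero. Two syzygies thus apply f
to both coordinates. Since ΩS_x = K(x, x+1), the factors of Ω^{2m}S_x sit in [f^m(x), f^m(x+1)). By
`gc_cInt_ψInt`, f is left adjoint to the lift of ψ, and so are their iterates; hence this interval
is the fibre of ψ^m over x.

The bound on pd keeps each module nonzero before its syzygy is taken. This matters because the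
projective cover of a zero K(x, y) is 0 and not P_y. -/

noncomputable section

namespace Nakayama

open Polynomial

/-! ### Ideals generated by paths -/

namespace PathAlgebra

variable {k : Type u} [Field k] {n : ℕ} [NeZero n]

/-- A two-sided ideal generated by nontrivial paths is spanned by the nontrivial paths it
contains. -/
theorem apply_eq_zero_of_mem_span (R : Set (CyclicPath n)) (hR : ∀ p ∈ R, 0 < p.length)
    (x : PathAlgebra k n) (hx : x ∈ TwoSidedIdeal.span (ofPath k '' R)) (p : CyclicPath n)
    (hp : ofPath k p ∉ TwoSidedIdeal.span (ofPath k '' R) ∨ p.length = 0) :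
    (show CyclicPath n →₀ k from x) p = 0 := by
  set I := TwoSidedIdeal.span (ofPath k '' R) with hI
  -- `T` is shown to be a two-sided ideal. It contains the generators, hence all of `I`, and every
  -- coordinate at a path outside its spanning set vanishes on it.
  let T : Submodule k (PathAlgebra k n) :=
    Submodule.span k (ofPath k '' {p | ofPath k p ∈ I ∧ 0 < p.length})
  have hmul : ∀ p q : CyclicPath n, pathMul k p q = 0 ∨
      (pathMul k p q = ofPath k ⟨p.start, p.length + q.length⟩) := by
    intro p q
    unfold pathMul
    split_ifs <;> simp
  have hleft : ∀ x y : PathAlgebra k n, y ∈ T → x * y ∈ T := by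
    intro x y hy
    have : T ≤ T.comap (mulHom k n x) := by
      refine Submodule.span_le.2 ?_
      rintro _ ⟨p, ⟨hp, hp0⟩, rfl⟩
      have key : (⊤ : Submodule k (PathAlgebra k n)) ≤
          T.comap ((mulHom k n).flip (ofPath k p)) := by
        have htop : Submodule.span k (Set.range (ofPath k (n := n))) = ⊤ :=
          (Finsupp.basisSingleOne (R := k) (ι := CyclicPath n)).span_eq
        rw [← htop]
        refine Submodule.span_le.2 ?_
        rintro _ ⟨q, rfl⟩
        change ofPath k q * ofPath k p ∈ T
        have h1 : ofPath k q * ofPath k p ∈ I := I.mul_mem_left _ _ hp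
        rw [ofPath_mul_ofPath] at h1 ⊢
        rcases hmul q p with h | h
        · rw [h]; exact T.zero_mem
        · rw [h] at h1 ⊢
          exact Submodule.subset_span ⟨_, ⟨h1, by simp; omega⟩, rfl⟩
      exact key (Submodule.mem_top (x := x))
    exact this hy
  have hright : ∀ x y : PathAlgebra k n, x ∈ T → x * y ∈ T := by
    intro x y hx
    have : T ≤ T.comap ((mulHom k n).flip y) := by
      refine Submodule.span_le.2 ?_
      rintro _ ⟨p, ⟨hp, hp0⟩, rfl⟩
      have key : (⊤ : Submodule k (PathAlgebra k n)) ≤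
          T.comap (mulHom k n (ofPath k p)) := by
        have htop : Submodule.span k (Set.range (ofPath k (n := n))) = ⊤ :=
          (Finsupp.basisSingleOne (R := k) (ι := CyclicPath n)).span_eq
        rw [← htop]
        refine Submodule.span_le.2 ?_
        rintro _ ⟨q, rfl⟩
        change ofPath k p * ofPath k q ∈ T
        have h1 : ofPath k p * ofPath k q ∈ I := I.mul_mem_right _ _ hp
        rw [ofPath_mul_ofPath] at h1 ⊢
        rcases hmul p q with h | h
        · rw [h]; exact T.zero_mem
        · rw [h] at h1 ⊢
          exact Submodule.subset_span ⟨_, ⟨h1, by simp; omega⟩, rfl⟩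
      exact key (Submodule.mem_top (x := y))
    exact this hx
  let T' : TwoSidedIdeal (PathAlgebra k n) := TwoSidedIdeal.mk' T T.zero_mem
    (fun h h' => T.add_mem h h') (fun h => T.neg_mem h) (fun h => hleft _ _ h)
    (fun h => hright _ _ h)
  have hle : I ≤ T' := by
    rw [hI, TwoSidedIdeal.span_le]
    rintro _ ⟨p, hp, rfl⟩
    refine (TwoSidedIdeal.mem_mk' _ _ _ _ _ _ _).2 (Submodule.subset_span ⟨p, ⟨?_, hR p hp⟩, rfl⟩)
    exact TwoSidedIdeal.subset_span ⟨p, hp, rfl⟩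
  have hxT : x ∈ T := (TwoSidedIdeal.mem_mk' _ _ _ _ _ _ _).1 (hle hx)
  have : T ≤ LinearMap.ker (Finsupp.lapply p : (CyclicPath n →₀ k) →ₗ[k] k) := by
    refine Submodule.span_le.2 ?_
    rintro _ ⟨q, ⟨hq, hq0⟩, rfl⟩
    have hne : q ≠ p := by
      rintro rfl
      rcases hp with h | h
      · exact h hq
      · omega
    exact Finsupp.single_eq_of_ne hne.symm
  exact this hxT

end PathAlgebra

/-! ### The basis of nonzero paths; the numbers c_a and q_a -/

namespace NakayamaStructure

variable {k : Type u} [Field k] {n : ℕ} [NeZero n] {A : Type v} [Ring A] [Algebra k A]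
  (N : NakayamaStructure k n A)

/-- The `k`-linear projection of the path algebra onto `A`. -/
def proj : PathAlgebra k n →ₗ[k] A where
  toFun x := N.iso (RingCon.toQuotient x)
  map_add' x y := by rw [← map_add]; rfl
  map_smul' r x := by rw [RingHom.id_apply, ← map_smul]; rfl

theorem proj_mul (x y : PathAlgebra k n) : N.proj (x * y) = N.proj x * N.proj y :=
  map_mul N.iso (RingCon.toQuotient x) (RingCon.toQuotient y)

theorem proj_surjective : Function.Surjective N.proj := fun y => by
  obtain ⟨x, hx⟩ := Quotient.exists_rep (N.iso.symm y)
  refine ⟨x, ?_⟩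
  change N.iso (RingCon.toQuotient x) = y
  rw [← N.iso.apply_symm_apply y, ← hx]
  rfl

theorem proj_eq_zero_iff (x : PathAlgebra k n) : N.proj x = 0 ↔
    x ∈ TwoSidedIdeal.span (PathAlgebra.ofPath k '' (N.relations : Set (CyclicPath n))) := by
  change N.iso (RingCon.toQuotient x) = 0 ↔ _
  rw [map_eq_zero_iff N.iso N.iso.injective, TwoSidedIdeal.mem_iff]
  exact RingCon.eq _

/-- The image in `A` of the path of length `l` starting at `a`. -/
def pathElt (a : ZMod n) (l : ℕ) : A := N.proj (PathAlgebra.ofPath k ⟨a, l⟩)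

theorem e_eq (a : ZMod n) : N.e a = N.pathElt a 0 := rfl

theorem pathElt_mul_of_eq {a b : ZMod n} {l : ℕ} (h : a + l = b) (j : ℕ) :
    N.pathElt a l * N.pathElt b j = N.pathElt a (l + j) := by
  rw [pathElt, pathElt, ← proj_mul, PathAlgebra.ofPath_mul_ofPath, PathAlgebra.pathMul,
    if_pos (by exact h)]
  rfl

theorem pathElt_mul_of_ne {a b : ZMod n} {l : ℕ} (h : a + l ≠ b) (j : ℕ) :
    N.pathElt a l * N.pathElt b j = 0 := by
  rw [pathElt, pathElt, ← proj_mul, PathAlgebra.ofPath_mul_ofPath, PathAlgebra.pathMul,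
    if_neg (by exact h), map_zero]

theorem span_pathElt :
    Submodule.span k (Set.range fun p : CyclicPath n => N.pathElt p.start p.length) = ⊤ := by
  have htop : Submodule.span k (Set.range (PathAlgebra.ofPath k (n := n))) = ⊤ :=
    (Finsupp.basisSingleOne (R := k) (ι := CyclicPath n)).span_eq
  have h := congrArg (Submodule.map N.proj) htop
  rw [Submodule.map_span, Submodule.map_top, LinearMap.range_eq_top.2 N.proj_surjective,
    ← Set.range_comp] at h
  exact h

/-- The coordinate functionals with respect to the nonzero paths. -/
theorem exists_coord {a : ZMod n} {l : ℕ} (h : N.pathElt a l ≠ 0 ∨ l = 0) :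
    ∃ κ : A →ₗ[k] k, κ (N.pathElt a l) = 1 ∧
      ∀ b j, ¬ (b = a ∧ j = l) → κ (N.pathElt b j) = 0 := by
  let co : PathAlgebra k n →ₗ[k] k :=
    (Finsupp.lapply ⟨a, l⟩ : (CyclicPath n →₀ k) →ₗ[k] k)
  have hker : LinearMap.ker N.proj ≤ LinearMap.ker co := by
    intro x hx
    refine PathAlgebra.apply_eq_zero_of_mem_span (N.relations : Set (CyclicPath n)) N.length_pos x
      ((N.proj_eq_zero_iff x).1 hx) ⟨a, l⟩ ?_
    rwa [← proj_eq_zero_iff]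
  let κ : A →ₗ[k] k := (LinearMap.ker N.proj).liftQ co hker ∘ₗ
    (N.proj.quotKerEquivOfSurjective N.proj_surjective).symm.toLinearMap
  have hκ : ∀ x, κ (N.proj x) = co x := by
    intro x
    have : (N.proj.quotKerEquivOfSurjective N.proj_surjective).symm (N.proj x) =
        Submodule.Quotient.mk x := by
      rw [LinearEquiv.symm_apply_eq]; rfl
    change (LinearMap.ker N.proj).liftQ co hker
      ((N.proj.quotKerEquivOfSurjective N.proj_surjective).symm (N.proj x)) = _
    rw [this]; rfl
  refine ⟨κ, (hκ _).trans (Finsupp.single_eq_same), fun b j hbj => (hκ _).trans ?_⟩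
  refine Finsupp.single_eq_of_ne ?_
  rintro ⟨⟩
  exact hbj ⟨rfl, rfl⟩

theorem pathElt_zero_ne (a : ZMod n) : N.pathElt a 0 ≠ 0 := by
  obtain ⟨κ, h, -⟩ := N.exists_coord (a := a) (Or.inr rfl)
  intro h0
  rw [h0, map_zero] at h
  exact zero_ne_one h

theorem basisMonomials_eq_X_pow (j : ℕ) : basisMonomials k j = X ^ j := by
  rw [coe_basisMonomials, ← monomial_one_right_eq_X_pow]

/-- The linear map sending `X ^ j` to the path of length `j` starting at `a`. -/
def polyMap (a : ZMod n) : k[X] →ₗ[k] A := (basisMonomials k).constr k (N.pathElt a)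

theorem polyMap_X_pow (a : ZMod n) (j : ℕ) : N.polyMap a (X ^ j) = N.pathElt a j := by
  rw [polyMap, ← basisMonomials_eq_X_pow, Module.Basis.constr_basis]

theorem polyMap_one (a : ZMod n) : N.polyMap a 1 = N.pathElt a 0 := by
  rw [← pow_zero X, polyMap_X_pow]

theorem poly_hom_ext {M : Type*} [AddCommMonoid M] [Module k M] {f g : k[X] →ₗ[k] M}
    (h : ∀ j : ℕ, f (X ^ j) = g (X ^ j)) : f = g := by
  refine (basisMonomials k).ext fun j => ?_
  rw [basisMonomials_eq_X_pow, h]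

theorem pathElt_mul_polyMap {a b : ZMod n} {l : ℕ} (h : a + l = b) (p : k[X]) :
    N.pathElt a l * N.polyMap b p = N.polyMap a (X ^ l * p) := by
  have : (LinearMap.mulLeft k (N.pathElt a l)) ∘ₗ N.polyMap b =
      N.polyMap a ∘ₗ LinearMap.mulLeft k (X ^ l) := poly_hom_ext fun j => by
    simp [polyMap_X_pow, N.pathElt_mul_of_eq h, ← pow_add]
  exact congrArg (fun f => f p) this

theorem exists_pathElt_mul (a : ZMod n) (l : ℕ) (y : A) :
    ∃ p, N.pathElt a l * y = N.polyMap a (X ^ l * p) := by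
  have h : (⊤ : Submodule k A) ≤ (LinearMap.range (N.polyMap a ∘ₗ LinearMap.mulLeft k (X ^ l))).comap
      (LinearMap.mulLeft k (N.pathElt a l)) := by
    rw [← N.span_pathElt]
    refine Submodule.span_le.2 ?_
    rintro _ ⟨p, rfl⟩
    by_cases hp : a + l = p.start
    · refine ⟨X ^ p.length, ?_⟩
      simp [polyMap_X_pow, N.pathElt_mul_of_eq hp, ← pow_add]
    · refine ⟨0, ?_⟩
      simp [N.pathElt_mul_of_ne hp]
  obtain ⟨p, hp⟩ := h (Submodule.mem_top (x := y))
  exact ⟨p, hp.symm⟩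

/-- Without a constant term every product path has length at least i + 1. This is the error term
absorbed in `J_zero_le`. -/
theorem exists_polyMap_mul (a b : ZMod n) (p : k[X]) (i : ℕ) :
    ∃ r, N.polyMap a (X * p) * N.pathElt b i = N.polyMap a (X ^ (i + 1) * r) := by
  have h : (⊤ : Submodule k k[X]) ≤
      (LinearMap.range (N.polyMap a ∘ₗ LinearMap.mulLeft k (X ^ (i + 1)))).comap
      (LinearMap.mulRight k (N.pathElt b i) ∘ₗ N.polyMap a ∘ₗ LinearMap.mulLeft k X) := by
    rw [← (basisMonomials k).span_eq]
    refine Submodule.span_le.2 ?_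
    rintro _ ⟨j, rfl⟩
    rw [basisMonomials_eq_X_pow]
    by_cases hp : a + ((j + 1 : ℕ) : ZMod n) = b
    · refine ⟨X ^ j, ?_⟩
      simp only [LinearMap.comp_apply, LinearMap.mulLeft_apply, LinearMap.mulRight_apply,
        ← pow_succ', polyMap_X_pow, ← pow_add, N.pathElt_mul_of_eq hp]
      congr 1; ring
    · refine ⟨0, ?_⟩
      simp only [LinearMap.comp_apply, LinearMap.mulLeft_apply, LinearMap.mulRight_apply,
        ← pow_succ', polyMap_X_pow, N.pathElt_mul_of_ne hp, map_zero]
  obtain ⟨r, hr⟩ := h (Submodule.mem_top (x := p))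
  exact ⟨r, hr.symm⟩

theorem coeff_eq_zero_of_polyMap_eq_zero {a : ZMod n} {p : k[X]} (hp : N.polyMap a p = 0) {j : ℕ}
    (hj : N.pathElt a j ≠ 0) : p.coeff j = 0 := by
  obtain ⟨κ, h1, h0⟩ := N.exists_coord (Or.inl hj)
  have : κ ∘ₗ N.polyMap a = lcoeff k j := poly_hom_ext fun i => by
    rw [LinearMap.comp_apply, polyMap_X_pow, lcoeff_apply, coeff_X_pow]
    split_ifs with hij
    · rw [← hij, h1]
    · exact h0 _ _ fun h => hij h.2.symm
  have h := congrArg (fun f => f p) this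
  rw [LinearMap.comp_apply, hp, map_zero] at h
  exact h.symm

theorem pathElt_eq_zero_of_le {a : ZMod n} {i j : ℕ} (hij : i ≤ j) (h : N.pathElt a i = 0) :
    N.pathElt a j = 0 := by
  obtain ⟨d, rfl⟩ := Nat.exists_eq_add_of_le hij
  rw [← N.pathElt_mul_of_eq rfl, h, zero_mul]

theorem pathElt_sub_eq_zero_of_le {b : ZMod n} {i j : ℕ} (hij : i ≤ j)
    (h : N.pathElt (b - i) i = 0) : N.pathElt (b - j) j = 0 := by
  obtain ⟨d, rfl⟩ := Nat.exists_eq_add_of_le hij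
  rw [add_comm i d, ← N.pathElt_mul_of_eq (b := b - i) (by push_cast; ring), h, mul_zero]

/-- The nonzero paths ending at b, one for each length l < d, form a basis of A e_b. -/
theorem finrank_span_e {b : ZMod n} {d : ℕ} (hd : ∀ l : ℕ, N.pathElt (b - l) l = 0 ↔ d ≤ l) :
    Module.finrank k (Ideal.span {N.e b} : Ideal A) = d := by
  let v : Fin d → A := fun l => N.pathElt (b - (l : ℕ)) l
  have hv : LinearIndependent k v := by
    rw [Fintype.linearIndependent_iff]
    intro g hg i
    obtain ⟨κ, h1, h0⟩ := N.exists_coord (a := b - ((i : ℕ) : ZMod n)) (l := i)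
      (Or.inl fun h => absurd ((hd i).1 h) (by omega))
    have h := congrArg κ hg
    rw [map_sum, map_zero, Finset.sum_eq_single i] at h
    · rwa [map_smul, h1, smul_eq_mul, mul_one] at h
    · intro j _ hji
      rw [map_smul, h0 _ _ fun h => hji (Fin.ext h.2), smul_zero]
    · exact fun h => absurd (Finset.mem_univ _) h
  have hspan : Submodule.span k (Set.range v) =
      Submodule.restrictScalars k (Ideal.span {N.e b} : Ideal A) := by
    apply le_antisymm
    · refine Submodule.span_le.2 ?_
      rintro _ ⟨l, rfl⟩
      refine Ideal.mem_span_singleton'.2 ⟨v l, ?_⟩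
      rw [e_eq]
      exact N.pathElt_mul_of_eq (by simp) 0
    · intro z hz
      obtain ⟨y, rfl⟩ := Ideal.mem_span_singleton'.1 hz
      have h : (⊤ : Submodule k A) ≤ (Submodule.span k (Set.range v)).comap
          (LinearMap.mulRight k (N.e b)) := by
        rw [← N.span_pathElt]
        refine Submodule.span_le.2 ?_
        rintro _ ⟨⟨a, l⟩, rfl⟩
        change N.pathElt a l * N.pathElt b 0 ∈ Submodule.span k (Set.range v)
        by_cases hp : a + l = b
        · rw [N.pathElt_mul_of_eq hp, add_zero]
          obtain rfl : a = b - l := eq_sub_of_add_eq hp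
          by_cases h0 : d ≤ l
          · rw [(hd l).2 h0]; exact Submodule.zero_mem _
          · exact Submodule.subset_span ⟨⟨l, not_le.1 h0⟩, rfl⟩
        · rw [N.pathElt_mul_of_ne hp]; exact Submodule.zero_mem _
      exact h (Submodule.mem_top (x := y))
  have h := finrank_span_eq_card hv
  rw [hspan, Fintype.card_fin] at h
  exact h

variable [FiniteDimensional k A]

/-- Otherwise `polyMap a` would embed k[X] in the finite-dimensional A. -/
theorem exists_pathElt_eq_zero (a : ZMod n) : ∃ l, N.pathElt a l = 0 := by
  by_contra! h
  have hinj : Function.Injective (N.polyMap a) := by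
    rw [← LinearMap.ker_eq_bot, LinearMap.ker_eq_bot']
    intro p hp
    ext j
    rw [N.coeff_eq_zero_of_polyMap_eq_zero hp (h j), coeff_zero]
  exact Polynomial.not_finite (R := k) (Module.Finite.of_injective _ hinj)

open Classical in
/-- The length of `P_a`: the number of nonzero paths starting at `a`. -/
def c (a : ZMod n) : ℕ := Nat.find (N.exists_pathElt_eq_zero a)

theorem pathElt_eq_zero_iff {a : ZMod n} {l : ℕ} : N.pathElt a l = 0 ↔ N.c a ≤ l := by
  classical
  exact ⟨fun h => Nat.find_min' _ h, fun h =>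
    N.pathElt_eq_zero_of_le h (Nat.find_spec (N.exists_pathElt_eq_zero a))⟩

theorem c_pos (a : ZMod n) : 0 < N.c a := by
  by_contra h
  exact N.pathElt_zero_ne a (N.pathElt_eq_zero_iff.2 (not_lt.1 h))

theorem polyMap_eq_zero_iff {a : ZMod n} {p : k[X]} : N.polyMap a p = 0 ↔ X ^ N.c a ∣ p := by
  constructor
  · intro h
    refine X_pow_dvd_iff.2 fun d hd => N.coeff_eq_zero_of_polyMap_eq_zero h fun h0 => ?_
    exact absurd (N.pathElt_eq_zero_iff.1 h0) (by omega)
  · rintro ⟨r, rfl⟩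
    rw [← N.pathElt_mul_polyMap rfl, N.pathElt_eq_zero_iff.2 le_rfl, zero_mul]

theorem exists_pathElt_sub_eq_zero (b : ZMod n) : ∃ l : ℕ, N.pathElt (b - l) l = 0 :=
  -- The start b - l varies with l, so l must bound all the `c a` at once.
  ⟨∑ a, N.c a, N.pathElt_eq_zero_iff.2
    (Finset.single_le_sum (fun a _ => Nat.zero_le (N.c a)) (Finset.mem_univ _))⟩

theorem pathElt_sub_eq_zero_iff {b : ZMod n} {l : ℕ} :
    N.pathElt (b - l) l = 0 ↔ N.q b ≤ l := by
  classical
  have hd : ∀ l : ℕ, N.pathElt (b - l) l = 0 ↔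
      Nat.find (N.exists_pathElt_sub_eq_zero b) ≤ l := fun l =>
    ⟨fun h => Nat.find_min' _ h, fun h =>
      N.pathElt_sub_eq_zero_of_le h (Nat.find_spec (N.exists_pathElt_sub_eq_zero b))⟩
  have hq : N.q b = Nat.find (N.exists_pathElt_sub_eq_zero b) :=
    Subspace.dual_finrank_eq.trans (N.finrank_span_e hd)
  rw [hq]
  exact hd l

end NakayamaStructure

/-! ### Projective covers and syzygies over a ring -/

section ProjectiveCovers

variable {R : Type u} [Ring R]

/-- Projective covers of isomorphic modules have isomorphic kernels. -/
theorem ProjectiveCover.nonempty_ker_equiv {M M' : ModuleCat.{v} R} (C : ProjectiveCover M)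
    (C' : ProjectiveCover M') (e : M ≃ₗ[R] M') :
    Nonempty (LinearMap.ker C.π ≃ₗ[R] LinearMap.ker C'.π) := by
  have := C.projective
  have := C'.projective
  obtain ⟨h, hh⟩ := Module.projective_lifting_property C'.π (e.toLinearMap ∘ₗ C.π) C'.surjective
  have hh' : ∀ x, C'.π (h x) = e (C.π x) := fun x => congrArg (fun f => f x) hh
  -- The range of `h` and ker π' span the target, so superfluity makes `h` onto. The same argument
  -- below makes its section `s` onto, so `h` is bijective.
  have hsurj : Function.Surjective h := by
    rw [← LinearMap.range_eq_top]
    refine C'.superfluous _ (eq_top_iff.2 fun y _ => ?_)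
    obtain ⟨x, hx⟩ := C.surjective (e.symm (C'.π y))
    refine Submodule.mem_sup.2 ⟨h x, ⟨x, rfl⟩, y - h x, ?_, by abel⟩
    rw [LinearMap.mem_ker, map_sub, hh', hx, e.apply_symm_apply, sub_self]
  obtain ⟨s, hs⟩ := Module.projective_lifting_property h LinearMap.id hsurj
  have hs' : ∀ y, h (s y) = y := fun y => congrArg (fun f => f y) hs
  have hrange : LinearMap.range s = ⊤ := by
    refine C.superfluous _ (eq_top_iff.2 fun x _ => ?_)
    refine Submodule.mem_sup.2 ⟨s (h x), ⟨h x, rfl⟩, x - s (h x), ?_, by abel⟩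
    rw [LinearMap.mem_ker, ← e.map_eq_zero_iff, ← hh', map_sub, hs', sub_self, map_zero]
  have hinj : Function.Injective h := by
    intro x y hxy
    obtain ⟨x, rfl⟩ := LinearMap.range_eq_top.1 hrange x
    obtain ⟨y, rfl⟩ := LinearMap.range_eq_top.1 hrange y
    rw [hs', hs'] at hxy
    rw [hxy]
  refine ⟨(LinearEquiv.ofBijective h ⟨hinj, hsurj⟩).ofSubmodules _ _ ?_⟩
  ext y
  constructor
  · rintro ⟨x, hx, rfl⟩
    rw [LinearMap.mem_ker]
    exact (hh' x).trans (by rw [LinearMap.mem_ker.1 hx, map_zero])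
  · intro hy
    obtain ⟨x, rfl⟩ := hsurj y
    refine ⟨x, ?_, rfl⟩
    rw [LinearMap.mem_ker, hh', e.map_eq_zero_iff] at hy
    exact hy

/-- Transport of a projective cover along an isomorphism. -/
def ProjectiveCover.ofEquiv {M M' : ModuleCat.{v} R} (C' : ProjectiveCover M') (e : M ≃ₗ[R] M') :
    ProjectiveCover M where
  P := C'.P
  projective := C'.projective
  π := e.symm.toLinearMap ∘ₗ C'.π
  surjective := e.symm.surjective.comp C'.surjective
  superfluous := fun X hX => C'.superfluous X (by rwa [LinearEquiv.ker_comp] at hX)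

/-- Replaces the arbitrarily chosen cover in `syzygy` by an explicit one. -/
theorem syzygy_equiv {M M' : ModuleCat.{v} R} (C' : ProjectiveCover M') (e : M ≃ₗ[R] M') :
    Nonempty (syzygy M ≃ₗ[R] LinearMap.ker C'.π) := by
  have h : Nonempty (ProjectiveCover M) := ⟨C'.ofEquiv e⟩
  rw [syzygy, dif_pos h]
  exact h.some.nonempty_ker_equiv C' e

/-- From 0 → ΩM → P → M → 0. It is used contrapositively, to pass a lower bound on pd, reduced by
one, to the syzygy. -/
theorem hasProjectiveDimensionLT_of_syzygy {M : ModuleCat.{max u v} R}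
    (C : ProjectiveCover M) {i : ℕ} (h : HasProjectiveDimensionLT (syzygy M) i) :
    HasProjectiveDimensionLT M (i + 1) := by
  obtain ⟨e⟩ := syzygy_equiv C (LinearEquiv.refl R M)
  let S : ShortComplex (ModuleCat R) := ShortComplex.mk
    (ModuleCat.ofHom (LinearMap.ker C.π).subtype) (ModuleCat.ofHom C.π) (by ext x; exact x.2)
  have hS : S.ShortExact := by
    refine { exact := ?_, mono_f := ?_, epi_g := ?_ }
    · rw [ShortComplex.moduleCat_exact_iff]
      exact fun x hx => ⟨⟨x, hx⟩, rfl⟩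
    · rw [ModuleCat.mono_iff_injective]
      exact Subtype.val_injective
    · rw [ModuleCat.epi_iff_surjective]
      exact C.surjective
  have h1 : HasProjectiveDimensionLT S.X₁ i := by
    have h' : HasProjectiveDimensionLT (ModuleCat.of R (syzygy M)) i := h
    exact hasProjectiveDimensionLT_of_iso e.toModuleIso i
  have h2 : HasProjectiveDimensionLT S.X₂ (i + 1) := by
    have hp : Projective C.P :=
      (IsProjective.iff_projective C.P).1 C.projective
    have : HasProjectiveDimensionLT C.P 1 := projective_iff_hasProjectiveDimensionLT_one.1 hp
    exact hasProjectiveDimensionLT_of_ge C.P 1 (i + 1) (by omega)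
  exact hS.hasProjectiveDimensionLT_X₃ i h1 h2

end ProjectiveCovers

open Polynomial

/-! ### The modules `J`, their covers and composition factors -/

namespace NakayamaStructure

variable {k : Type u} [Field k] {n : ℕ} [NeZero n] {A : Type v} [Ring A] [Algebra k A]
  (N : NakayamaStructure k n A)

/-- The right ideal generated by the path of length `l` starting at `a`; it is the `l`-th term of
the radical filtration of `P_a`. -/
def J (a : ZMod n) (l : ℕ) : Submodule Aᵐᵒᵖ A := Submodule.span Aᵐᵒᵖ {N.pathElt a l}

theorem mem_J {a : ZMod n} {l : ℕ} {z : A} : z ∈ N.J a l ↔ ∃ p, z = N.polyMap a (X ^ l * p) := by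
  rw [J, Submodule.mem_span_singleton]
  constructor
  · rintro ⟨y, rfl⟩
    exact N.exists_pathElt_mul a l y.unop
  · rintro ⟨p, rfl⟩
    exact ⟨op (N.polyMap (a + l) p), N.pathElt_mul_polyMap rfl p⟩

theorem pathElt_mem_J {a : ZMod n} {i j : ℕ} (h : i ≤ j) : N.pathElt a j ∈ N.J a i :=
  N.mem_J.2 ⟨X ^ (j - i), by rw [← pow_add, Nat.add_sub_cancel' h, polyMap_X_pow]⟩

theorem J_antitone (a : ZMod n) : Antitone (N.J a) := fun _ _ h =>
  (Submodule.span_singleton_le_iff_mem _ _).2 (N.pathElt_mem_J h)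

theorem pathElt_zero_notMem_J_one (a : ZMod n) : N.pathElt a 0 ∉ N.J a 1 := by
  intro h
  obtain ⟨p, hp⟩ := N.mem_J.1 h
  rw [← polyMap_one, ← sub_eq_zero, ← map_sub] at hp
  have := N.coeff_eq_zero_of_polyMap_eq_zero hp (N.pathElt_zero_ne a)
  simp at this

theorem pathElt_mul_mem_J {a b : ZMod n} {l : ℕ} (h : a + l = b) {z : A} (hz : z ∈ N.J b 0) :
    N.pathElt a l * z ∈ N.J a l := by
  obtain ⟨p, rfl⟩ := N.mem_J.1 hz
  rw [N.pathElt_mul_polyMap h]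
  exact N.mem_J.2 ⟨_, rfl⟩

/-- Left multiplication by the idempotent e_a splits the inclusion of P_a in A. -/
theorem projective_P (a : ZMod n) : Module.Projective Aᵐᵒᵖ (N.J a 0) := by
  have hA : Module.Projective Aᵐᵒᵖ A :=
    Module.Projective.of_equiv ({ (opAddEquiv (α := A)).symm with
      map_smul' := fun _ _ => rfl } : Aᵐᵒᵖ ≃ₗ[Aᵐᵒᵖ] A)
  refine Module.Projective.of_split (N.J a 0).subtype
    ((LinearMap.mulLeft Aᵐᵒᵖ (N.pathElt a 0)).codRestrict (N.J a 0) fun z =>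
      N.mem_J.2 (N.exists_pathElt_mul a 0 z)) ?_
  ext ⟨z, hz⟩
  obtain ⟨p, rfl⟩ := N.mem_J.1 hz
  change N.pathElt a 0 * N.polyMap a (X ^ 0 * p) = N.polyMap a (X ^ 0 * p)
  rw [N.pathElt_mul_polyMap (by simp)]
  simp

/-- The maximal submodule of `P_a`. -/
def radP (a : ZMod n) : Submodule Aᵐᵒᵖ (N.P a) := (N.J a 1).comap (N.P a).subtype

theorem radP_ne_top (a : ZMod n) : N.radP a ≠ ⊤ := fun h =>
  N.pathElt_zero_notMem_J_one a
    (h ▸ Submodule.mem_top : (⟨N.pathElt a 0, N.pathElt_mem_J le_rfl⟩ : N.P a) ∈ N.radP a)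

theorem exists_mul_e_ne_zero_iff {a b : ZMod n} {l : ℕ} :
    (∃ z ∈ N.J a l, z * N.e b ≠ 0) ↔ ∃ j, l ≤ j ∧ N.pathElt a j ≠ 0 ∧ a + j = b := by
  constructor
  · rintro ⟨z, hz, hzb⟩
    by_contra! h
    obtain ⟨p, rfl⟩ := N.mem_J.1 hz
    have : LinearMap.mulRight k (N.e b) ∘ₗ N.polyMap a ∘ₗ LinearMap.mulLeft k (X ^ l) = 0 :=
      poly_hom_ext fun j => by
        simp only [LinearMap.comp_apply, LinearMap.mulLeft_apply, LinearMap.mulRight_apply,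
          ← pow_add, polyMap_X_pow, LinearMap.zero_apply]
        by_cases h0 : N.pathElt a (l + j) = 0
        · rw [h0, zero_mul]
        · exact N.pathElt_mul_of_ne (h _ (by omega) h0) 0
    exact hzb (congrArg (fun f => f p) this)
  · rintro ⟨j, hj, h0, hb⟩
    refine ⟨_, N.pathElt_mem_J hj, ?_⟩
    rwa [e_eq, N.pathElt_mul_of_eq hb]

/-- Left multiplication by the path of length `l` starting at `a`. -/
def mulPath {a b : ZMod n} {l : ℕ} (h : a + l = b) : N.P b →ₗ[Aᵐᵒᵖ] N.J a l :=
  (LinearMap.mulLeft Aᵐᵒᵖ (N.pathElt a l)).restrict fun _ hz => N.pathElt_mul_mem_J h hz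

theorem mulPath_surjective {a b : ZMod n} {l : ℕ} (h : a + l = b) :
    Function.Surjective (N.mulPath h) := by
  rintro ⟨z, hz⟩
  obtain ⟨p, rfl⟩ := N.mem_J.1 hz
  exact ⟨⟨N.polyMap b p, N.mem_J.2 ⟨p, by rw [pow_zero, one_mul]⟩⟩,
    Subtype.ext (N.pathElt_mul_polyMap h p)⟩

variable [FiniteDimensional k A]

theorem J_c (a : ZMod n) : N.J a (N.c a) = ⊥ :=
  (Submodule.span_singleton_eq_bot).2 (N.pathElt_eq_zero_iff.2 le_rfl)

/-- Multiplying by the path of length i from b gives a nonzero multiple of that path plus an element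
of `J b (i+1)`. Descending induction on i removes the latter. -/
theorem J_zero_le {b : ZMod n} {M : Submodule Aᵐᵒᵖ A} {p : k[X]} (hp : N.polyMap b p ∈ M)
    (h0 : p.coeff 0 ≠ 0) : N.J b 0 ≤ M := by
  have key : ∀ d, N.J b (N.c b - d) ≤ M := by
    intro d
    induction d with
    | zero => rw [Nat.sub_zero, J_c]; exact bot_le
    | succ d ih =>
      rcases Nat.eq_zero_or_pos (N.c b - d) with h | h
      · rwa [Nat.sub_succ, h, Nat.pred_zero, ← h]
      obtain ⟨i, hi⟩ := Nat.exists_eq_succ_of_ne_zero h.ne'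
      rw [hi] at ih
      rw [Nat.sub_succ, hi, Nat.pred_succ]
      refine (Submodule.span_singleton_le_iff_mem _ _).2 ?_
      obtain ⟨r, hr⟩ := N.exists_polyMap_mul b b p.divX i
      have h1 : N.polyMap b p * N.pathElt b i ∈ M := M.smul_mem (op (N.pathElt b i)) hp
      have h2 : N.polyMap b p * N.pathElt b i - N.polyMap b (X * p.divX) * N.pathElt b i ∈ M :=
        M.sub_mem h1 (ih (N.mem_J.2 ⟨r, hr⟩))
      rw [← sub_mul, ← map_sub] at h2
      have h3 : p - X * p.divX = p.coeff 0 • 1 := by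
        nth_rw 1 [← X_mul_divX_add p]
        rw [add_sub_cancel_left, smul_eq_C_mul, mul_one]
      rw [h3, map_smul, polyMap_one, smul_mul_assoc, N.pathElt_mul_of_eq (by simp), zero_add] at h2
      -- `M` is stable only under the right action of A, so the inverse scalar acts through its
      -- central image in A.
      have h4 := M.smul_mem (op (algebraMap k A (p.coeff 0)⁻¹)) h2
      rw [op_smul_eq_mul, ← Algebra.commutes, ← Algebra.smul_def, smul_smul, inv_mul_cancel₀ h0,
        one_smul] at h4
      exact h4
  have h := key (N.c b)
  rwa [Nat.sub_self] at h

/-- P_a is local: this identifies its Jacobson radical and makes every proper submodule superfluous.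
-/
theorem le_radP {a : ZMod n} {M : Submodule Aᵐᵒᵖ (N.P a)} (hM : M ≠ ⊤) : M ≤ N.radP a := by
  rintro ⟨z, hz⟩ hzM
  obtain ⟨p, hp⟩ := N.mem_J.1 hz
  rw [pow_zero, one_mul] at hp
  subst hp
  by_cases h0 : p.coeff 0 = 0
  · obtain ⟨r, rfl⟩ := X_dvd_iff.2 h0
    exact N.mem_J.2 ⟨r, by rw [pow_one]; rfl⟩
  · refine absurd (eq_top_iff.2 ?_) hM
    have h : N.J a 0 ≤ M.map (N.P a).subtype := N.J_zero_le ⟨_, hzM, rfl⟩ h0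
    rintro ⟨y, hy⟩ -
    obtain ⟨⟨y', hy'⟩, h1, rfl⟩ := h hy
    exact h1

theorem jacobson_P (a : ZMod n) : Module.jacobson Aᵐᵒᵖ (N.P a) = N.radP a := by
  have hco : IsCoatom (N.radP a) := ⟨N.radP_ne_top a, fun M hM => by
    by_contra h
    exact absurd (N.le_radP h) (not_le_of_gt hM)⟩
  refine le_antisymm (sInf_le hco) (le_sInf fun M hM => ?_)
  exact (hM.le_iff_eq hco.1).1 (N.le_radP hM.1) ▸ le_rfl

theorem superfluous_of_ne_top {a : ZMod n} {K : Submodule Aᵐᵒᵖ (N.P a)} (hK : K ≠ ⊤)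
    (M : Submodule Aᵐᵒᵖ (N.P a)) (h : M ⊔ K = ⊤) : M = ⊤ := by
  by_contra hM
  exact N.radP_ne_top a (top_le_iff.1 (h ▸ sup_le (N.le_radP hM) (N.le_radP hK)))

/-- The projective cover of the simple module at `a`. -/
def coverS (a : ZMod n) : ProjectiveCover (N.S a) where
  P := ModuleCat.of Aᵐᵒᵖ (N.P a)
  projective := N.projective_P a
  π := (Module.jacobson Aᵐᵒᵖ (N.P a)).mkQ
  surjective := Submodule.mkQ_surjective _
  superfluous := N.superfluous_of_ne_top (by
    have h := (Submodule.ker_mkQ _).trans (N.jacobson_P a)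
    exact fun h' => N.radP_ne_top a (h.symm.trans h'))

theorem ker_coverS_equiv (a : ZMod n) :
    Nonempty (LinearMap.ker (N.coverS a).π ≃ₗ[Aᵐᵒᵖ] N.J a 1) := by
  have h : LinearMap.ker (N.coverS a).π = N.radP a :=
    (Submodule.ker_mkQ _).trans (N.jacobson_P a)
  rw [h]
  exact ⟨Submodule.comapSubtypeEquivOfLe (N.J_antitone a (Nat.zero_le 1))⟩

/-- X^c_a divides X^l p exactly when X^(c_a - l) divides p. -/
theorem ker_mulPath {a b : ZMod n} {l : ℕ} (h : a + l = b) (hl : l ≤ N.c a) :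
    LinearMap.ker (N.mulPath h) = (N.J b (N.c a - l)).comap (N.P b).subtype := by
  ext ⟨z, hz⟩
  obtain ⟨p, rfl⟩ := N.mem_J.1 hz
  rw [LinearMap.mem_ker, Subtype.ext_iff]
  change N.pathElt a l * N.polyMap b (X ^ 0 * p) = 0 ↔ N.polyMap b (X ^ 0 * p) ∈ N.J b (N.c a - l)
  rw [pow_zero, one_mul, N.mem_J]
  constructor
  · intro h0
    rw [N.pathElt_mul_polyMap h, polyMap_eq_zero_iff] at h0
    obtain ⟨r, hr⟩ := h0
    refine ⟨r, congrArg _ (mul_left_cancel₀ (pow_ne_zero l X_ne_zero) ?_)⟩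
    rw [hr, ← mul_assoc, ← pow_add, Nat.add_sub_cancel' hl]
  · rintro ⟨r, hr⟩
    rw [hr, N.pathElt_mul_polyMap h, polyMap_eq_zero_iff, ← mul_assoc, ← pow_add,
      Nat.add_sub_cancel' hl]
    exact dvd_mul_right _ _

/-- The projective cover of the module generated by a nonzero path. -/
def coverJ {a b : ZMod n} {l : ℕ} (h : a + l = b) (hl : l < N.c a) :
    ProjectiveCover (ModuleCat.of Aᵐᵒᵖ (N.J a l)) where
  P := ModuleCat.of Aᵐᵒᵖ (N.P b)
  projective := N.projective_P b
  π := N.mulPath h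
  surjective := N.mulPath_surjective h
  superfluous := N.superfluous_of_ne_top (by
    rw [N.ker_mulPath h hl.le]
    intro htop
    refine N.pathElt_zero_notMem_J_one b (N.J_antitone b (Nat.sub_pos_of_lt hl) ?_)
    exact (htop ▸ Submodule.mem_top : (⟨N.pathElt b 0, N.pathElt_mem_J le_rfl⟩ : N.P b) ∈
      (N.J b (N.c a - l)).comap (N.P b).subtype))

theorem ker_coverJ_equiv {a b : ZMod n} {l : ℕ} (h : a + l = b) (hl : l < N.c a) :
    Nonempty (LinearMap.ker (N.coverJ h hl).π ≃ₗ[Aᵐᵒᵖ] N.J b (N.c a - l)) := by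
  have h : LinearMap.ker (N.coverJ h hl).π = _ := N.ker_mulPath h hl.le
  rw [h]
  exact ⟨Submodule.comapSubtypeEquivOfLe (N.J_antitone b (Nat.zero_le _))⟩

/-- The simple module `S_b` is a subfactor of `M` if and only if `e_b` acts nontrivially. -/
theorem isSubfactor_S_iff {b : ZMod n} {M : ModuleCat.{v} Aᵐᵒᵖ} :
    IsSubfactor (N.S b) M ↔ ∃ x : M, op (N.e b) • x ≠ 0 := by
  have he : N.e b * N.e b = N.e b := N.pathElt_mul_of_eq (by simp) 0
  have heP : N.e b ∈ N.P b := N.pathElt_mem_J le_rfl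
  constructor
  · rintro ⟨V, W, -, ⟨φ'⟩⟩
    let φ : (V ⧸ W.submoduleOf V) ≃ₗ[Aᵐᵒᵖ] N.P b ⧸ Module.jacobson Aᵐᵒᵖ (N.P b) := φ'
    let s : N.P b ⧸ Module.jacobson Aᵐᵒᵖ (N.P b) := Submodule.Quotient.mk ⟨N.e b, heP⟩
    have hs : op (N.e b) • s ≠ 0 := by
      rw [← Submodule.Quotient.mk_smul, Ne, Submodule.Quotient.mk_eq_zero, jacobson_P]
      intro h
      refine N.pathElt_zero_notMem_J_one b ?_
      have h' : N.e b * N.e b ∈ N.J b 1 := h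
      rwa [he] at h'
    obtain ⟨x, hx⟩ := Submodule.Quotient.mk_surjective _ (φ.symm s)
    refine ⟨x, fun h => hs ?_⟩
    have h' : op (N.e b) • x = 0 := Subtype.ext h
    have h2 : op (N.e b) • φ.symm s = 0 := by
      rw [← hx, ← Submodule.Quotient.mk_smul, h', Submodule.Quotient.mk_zero]
    rw [← map_smul, φ.symm.map_eq_zero_iff] at h2
    exact h2
  · rintro ⟨x, hx⟩
    let g : N.P b →ₗ[Aᵐᵒᵖ] M :=
      { toFun := fun y => op (y : A) • x
        map_add' := fun y y' => by rw [Submodule.coe_add, MulOpposite.op_add, add_smul]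
        map_smul' := fun r y => by
          rw [RingHom.id_apply, smul_smul]; rfl }
    -- `g` does not kill e_b, so its kernel is proper. Hence im g modulo the image of the radical is
    -- still S_b.
    have hker : LinearMap.ker g ≤ Module.jacobson Aᵐᵒᵖ (N.P b) := by
      rw [jacobson_P]
      refine N.le_radP fun h => hx ?_
      exact (h ▸ Submodule.mem_top : (⟨N.e b, heP⟩ : N.P b) ∈ LinearMap.ker g)
    let Y := (Module.jacobson Aᵐᵒᵖ (N.P b)).map g
    let h : N.P b →ₗ[Aᵐᵒᵖ] _ := (Y.submoduleOf (LinearMap.range g)).mkQ ∘ₗ g.rangeRestrict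
    have hh : Function.Surjective h :=
      (Submodule.mkQ_surjective _).comp g.surjective_rangeRestrict
    have hkh : LinearMap.ker h = Module.jacobson Aᵐᵒᵖ (N.P b) := by
      rw [LinearMap.ker_comp, Submodule.ker_mkQ]
      ext y
      constructor
      · rintro ⟨y', hy', hy⟩
        have hsub : y - y' ∈ LinearMap.ker g := by
          rw [LinearMap.mem_ker, map_sub, sub_eq_zero]
          exact hy.symm
        have := Submodule.add_mem _ (hker hsub) hy'
        rwa [sub_add_cancel] at this
      · exact fun hy => ⟨y, hy, rfl⟩
    refine ⟨LinearMap.range g, Y, LinearMap.map_le_range, ⟨?_⟩⟩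
    exact ((Submodule.quotEquivOfEq _ _ hkh.symm).trans (h.quotKerEquivOfSurjective hh)).symm

theorem isSubfactor_S_S_iff {a b : ZMod n} : IsSubfactor (N.S b) (N.S a) ↔ b = a := by
  rw [isSubfactor_S_iff]
  have heP : N.e a ∈ N.P a := N.pathElt_mem_J le_rfl
  constructor
  · rintro ⟨x, hx⟩
    by_contra hba
    obtain ⟨⟨z, hz⟩, rfl⟩ := Submodule.Quotient.mk_surjective _ x
    refine hx ((Submodule.Quotient.mk_eq_zero _).2 ?_)
    rw [jacobson_P]
    change z * N.e b ∈ N.J a 1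
    obtain ⟨p, rfl⟩ := N.mem_J.1 hz
    rw [pow_zero, one_mul, ← X_mul_divX_add p, map_add, add_mul, ← mul_one (C _), ← smul_eq_C_mul,
      map_smul, smul_mul_assoc, polyMap_one, e_eq,
      N.pathElt_mul_of_ne (by simpa using Ne.symm hba), smul_zero, add_zero]
    exact (N.J a 1).smul_mem (op (N.pathElt b 0)) (N.mem_J.2 ⟨_, by rw [pow_one]⟩)
  · rintro rfl
    refine ⟨Submodule.Quotient.mk ⟨N.e b, heP⟩, fun h => ?_⟩
    have h := (Submodule.Quotient.mk_eq_zero _).1 h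
    rw [jacobson_P] at h
    refine N.pathElt_zero_notMem_J_one b ?_
    have h' : N.e b * N.e b ∈ N.J b 1 := h
    rwa [e_eq, N.pathElt_mul_of_eq (by simp) 0] at h'

end NakayamaStructure

/-! ### Lifting to the integers: the Galois connection and iterated syzygies -/

namespace NakayamaStructure

variable {k : Type u} [Field k] {n : ℕ} [NeZero n] {A : Type v} [Ring A] [Algebra k A]
  (N : NakayamaStructure k n A)

/-- The lift to `ℤ` of the map `a ↦ a - q_a`. -/
def ψInt (y : ℤ) : ℤ := y - N.q y

theorem cast_ψInt_iterate (m : ℕ) (y : ℤ) : ((N.ψInt^[m] y : ℤ) : ZMod n) = N.ψ^[m] y :=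
  Function.Semiconj.iterate_right (f := ((↑) : ℤ → ZMod n)) (ga := N.ψInt) (gb := N.ψ)
    (fun x => by simp [ψInt, ψ]) m y

variable [FiniteDimensional k A]

/-- The lift to `ℤ` of the map `a ↦ a + c_a`. -/
def cInt (x : ℤ) : ℤ := x + N.c x

theorem lt_cInt (x : ℤ) : x < N.cInt x := by
  have := N.c_pos x
  unfold cInt
  omega

/-- For x ≤ y both inequalities say that the path from x to y vanishes in A. For y < x both fail. -/
theorem gc_cInt_ψInt : GaloisConnection N.cInt N.ψInt := by
  intro x y
  rcases lt_or_ge y x with h | h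
  · have h1 := N.lt_cInt x
    have h2 : N.ψInt y ≤ y := by unfold ψInt; omega
    constructor <;> intro <;> omega
  · obtain ⟨l, rfl⟩ := Int.le.dest h
    have h1 := N.pathElt_eq_zero_iff (a := x) (l := l)
    have h2 := N.pathElt_sub_eq_zero_iff (b := ((x + l : ℤ) : ZMod n)) (l := l)
    rw [show ((x + l : ℤ) : ZMod n) - (l : ZMod n) = x by push_cast; ring, h1] at h2
    unfold cInt ψInt
    omega

theorem cInt_mono : Monotone N.cInt := N.gc_cInt_ψInt.monotone_l

/-- Galois connections compose, so the interval means x ≤ ψ^m(t) < x + 1 for the lifted ψ. -/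
theorem iterate_mem_interval_iff (m : ℕ) (x t : ℤ) :
    (N.cInt^[m] x ≤ t ∧ t < N.cInt^[m] (x + 1)) ↔ N.ψInt^[m] t = x := by
  have gc : GaloisConnection N.cInt^[m] N.ψInt^[m] := by
    induction m with
    | zero => exact GaloisConnection.id
    | succ m ih =>
      rw [Function.iterate_succ, Function.iterate_succ']
      exact N.gc_cInt_ψInt.compose ih
  rw [gc x t, ← not_le, gc (x + 1) t]
  omega

/-- The uniserial module with composition factors `S_y, …, S_{x + c_x - 1}`, as a submodule
of `P_x`. -/
def K (p : ℤ × ℤ) : ModuleCat.{v} Aᵐᵒᵖ := ModuleCat.of Aᵐᵒᵖ (N.J p.1 (p.2 - p.1).toNat)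

/-- The effect of taking syzygies on the modules `K`. -/
def syzygyStep (p : ℤ × ℤ) : ℤ × ℤ := (p.2, N.cInt p.1)

theorem syzygyStep_iterate (m : ℕ) (p : ℤ × ℤ) :
    N.syzygyStep^[2 * m] p = (N.cInt^[m] p.1, N.cInt^[m] p.2) := by
  induction m with
  | zero => rfl
  | succ m ih =>
    rw [Nat.mul_succ, Function.iterate_succ_apply', Function.iterate_succ_apply', ih,
      Function.iterate_succ_apply', Function.iterate_succ_apply']
    rfl

/-- If `M ≅ K p` is not projective, its syzygies are described by `syzygyStep`. -/
theorem syzygy_iterate_equiv (i : ℕ) (p : ℤ × ℤ) (M : ModuleCat.{v} Aᵐᵒᵖ) (h1 : p.1 ≤ p.2)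
    (h2 : p.2 ≤ N.cInt p.1) (e : M ≃ₗ[Aᵐᵒᵖ] N.K p) (hM : ¬ HasProjectiveDimensionLT M i) :
    Nonempty (syzygy^[i + 1] M ≃ₗ[Aᵐᵒᵖ] N.K (N.syzygyStep^[i + 1] p)) := by
  induction i generalizing p M with
  | zero => ?_
  | succ i ih => ?_
  all_goals
    obtain ⟨x, y⟩ := p
    dsimp only at h1 h2
    -- Equality would make M zero, contradicting `hM`.
    have hlt : y < N.cInt x := by
      refine lt_of_le_of_ne h2 fun h => hM ?_
      have hK : N.J x (y - x).toNat = ⊥ := by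
        rw [show (y - x).toNat = N.c x by rw [h, cInt]; omega, J_c]
      have hsub : Subsingleton (N.K (x, y)) :=
        show Subsingleton (N.J x (y - x).toNat) by rw [hK]; infer_instance
      have := e.toEquiv.subsingleton
      have hz := (ModuleCat.isZero_of_subsingleton M).hasProjectiveDimensionLT_zero
      exact hasProjectiveDimensionLT_of_ge M 0 _ (Nat.zero_le _)
    have hl : (y - x).toNat < N.c x := by unfold cInt at hlt; omega
    have hcast : (x : ZMod n) + ((y - x).toNat : ZMod n) = y := by
      rw [← Int.cast_natCast, ← Int.cast_add]
      congr 1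
      omega
    let C' := N.coverJ hcast hl
    obtain ⟨e1⟩ := syzygy_equiv (M := M) C' e
    obtain ⟨e2⟩ := N.ker_coverJ_equiv hcast hl
    have e3 : syzygy M ≃ₗ[Aᵐᵒᵖ] N.K (N.syzygyStep (x, y)) := by
      have h : N.c x - (y - x).toNat = (N.cInt x - y).toNat := by unfold cInt; omega
      rw [h] at e2
      exact e1.trans e2
  · exact ⟨e3⟩
  · rw [Function.iterate_succ_apply, Function.iterate_succ_apply]
    refine ih _ _ hlt.le (N.cInt_mono h1) e3 fun h => hM ?_
    exact hasProjectiveDimensionLT_of_syzygy (C'.ofEquiv e) h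

/-- The integer t is the lifted endpoint of a nonzero path from x of length at least y - x. -/
theorem isSubfactor_of_equiv_K {M : ModuleCat.{v} Aᵐᵒᵖ} {x y : ℤ} (h : x ≤ y)
    (e : M ≃ₗ[Aᵐᵒᵖ] N.K (x, y)) (b : ZMod n) :
    IsSubfactor (N.S b) M ↔ ∃ t : ℤ, (t : ZMod n) = b ∧ y ≤ t ∧ t < N.cInt x := by
  have h1 : (∃ z : M, op (N.e b) • z ≠ 0) ↔ ∃ z ∈ N.J x (y - x).toNat, z * N.e b ≠ 0 := by
    constructor
    · rintro ⟨z, hz⟩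
      refine ⟨(show N.J x (y - x).toNat from e z), Subtype.prop _, fun h0 => hz ?_⟩
      rw [← e.map_eq_zero_iff, map_smul]
      exact Subtype.ext h0
    · rintro ⟨z, hz, h0⟩
      let z' : N.K (x, y) := (⟨z, hz⟩ : N.J x (y - x).toNat)
      refine ⟨e.symm z', fun h => h0 ?_⟩
      rw [← map_smul, e.symm.map_eq_zero_iff] at h
      exact congrArg (fun w : N.J x (y - x).toNat => (w : A)) h
  rw [isSubfactor_S_iff, h1, exists_mul_e_ne_zero_iff]
  constructor
  · rintro ⟨j, hj, h0, rfl⟩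
    rw [Ne, pathElt_eq_zero_iff] at h0
    refine ⟨x + j, by push_cast; rfl, by omega, by unfold cInt; omega⟩
  · rintro ⟨t, rfl, h2, h3⟩
    unfold cInt at h3
    refine ⟨(t - x).toNat, by omega, ?_, ?_⟩
    · rw [Ne, pathElt_eq_zero_iff]; omega
    · rw [← Int.cast_natCast, ← Int.cast_add]
      congr 1
      omega

theorem isSubfactor_syzygy_iff (m : ℕ) (x : ℤ) (b : ZMod n)
    (hpd : ((2 * m : ℕ) : WithBot ℕ∞) ≤ projectiveDimension (N.S x) + 1) :
    IsSubfactor (N.S b) (syzygy^[2 * m] (N.S x)) ↔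
      ∃ t : ℤ, (t : ZMod n) = b ∧ N.ψInt^[m] t = x := by
  simp only [← N.iterate_mem_interval_iff]
  rcases m with _ | m
  -- No syzygy is taken here and S_x need not have the form `K`; the interval is just {x}.
  · rw [Nat.mul_zero, Function.iterate_zero_apply, isSubfactor_S_S_iff]
    constructor
    · rintro rfl
      exact ⟨x, rfl, le_rfl, lt_add_one x⟩
    · rintro ⟨t, rfl, h1, h2⟩
      congr 1
      change x ≤ t at h1
      change t < x + 1 at h2
      omega
  -- The bound reads pd S_x ≥ 2m + 1, so ΩS_x has pd at least 2m, as the remaining 2m + 1 syzygies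
  -- require.
  · have hS : ¬ HasProjectiveDimensionLT (N.S x) (2 * m + 1) := by
      intro h
      have h1 : projectiveDimension (N.S x) ≤ ((2 * m : ℕ) : WithBot ℕ∞) :=
        (projectiveDimension_le_iff _ _).2 h
      have h2 := hpd.trans (add_le_add_left h1 1)
      have h3 : 2 * (m + 1) ≤ 2 * m + 1 := by exact_mod_cast h2
      omega
    obtain ⟨e1⟩ := syzygy_equiv (N.coverS x) (LinearEquiv.refl Aᵐᵒᵖ (N.S x))
    obtain ⟨e2⟩ := N.ker_coverS_equiv x
    have e3 : syzygy (N.S x) ≃ₗ[Aᵐᵒᵖ] N.K (x, x + 1) := by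
      have h : (1 : ℕ) = (x + 1 - x).toNat := by omega
      rw [h] at e2
      exact e1.trans e2
    obtain ⟨e4⟩ := N.syzygy_iterate_equiv (2 * m) (x, x + 1) (syzygy (N.S x)) (by simp)
      (by have := N.lt_cInt x; simpa using this) e3
      fun h => hS (hasProjectiveDimensionLT_of_syzygy (N.coverS x) h)
    have hstep : N.syzygyStep^[2 * m + 1] (x, x + 1) =
        (N.cInt^[m] (x + 1), N.cInt^[m + 1] x) := by
      rw [Function.iterate_succ_apply', syzygyStep_iterate, Function.iterate_succ_apply' N.cInt]
      rfl
    rw [hstep] at e4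
    rw [Function.iterate_succ_apply' N.cInt m (x + 1)]
    exact N.isSubfactor_of_equiv_K (N.cInt_mono.iterate m (N.lt_cInt x)) e4 b

end NakayamaStructure

end Nakayama

end

theorem proposition3p6 {k : Type u} [Field k] {n : ℕ} [NeZero n]
    {A : Type v} [Ring A] [Algebra k A] [FiniteDimensional k A]
    (N : Nakayama.NakayamaStructure k n A) (m : ℕ) (a b : ZMod n)
    (hpd : ((2 * m : ℕ) : WithBot ℕ∞) ≤ projectiveDimension (N.S a) + 1) :
    Nakayama.IsSubfactor (N.S b) (Nakayama.syzygy^[2 * m] (N.S a)) ↔ N.ψ^[m] b = a := by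
  constructor
  · obtain ⟨x, rfl⟩ := ZMod.intCast_surjective a
    rw [N.isSubfactor_syzygy_iff m x b hpd]
    rintro ⟨t, rfl, rfl⟩
    rw [N.cast_ψInt_iterate]
  -- Any lift of b will do, provided its image under the lifted ψ^m is taken as the lift of a.
  · obtain ⟨t, rfl⟩ := ZMod.intCast_surjective b
    rw [← N.cast_ψInt_iterate]
    rintro rfl
    exact (N.isSubfactor_syzygy_iff m _ _ hpd).2 ⟨t, rfl, rfl⟩
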